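/- For $a\in\{1,2,3\}$ and integers $m,n\ge 0$, let $rrg_{3,a}(m,n)$ denote the number of partitions $\lambda_1\ge\lambda_2\ge\dots\ge\lambda_m\ge 1$ of $n$ into exactly $m$ parts such that $\lambda_i\ge\lambda_{i+2}+2$ for all $1\le i\le m-2$ and at most $a-1$ of the parts are equal to $1$ (the empty partition being counted for $m=n=0$). Let $$T_a(x)=\sum_{m,n\ge 0} rrg_{3,a}(m,n)\,x^m q^n\in\mathbb{Z}[[x,q]],$$ and write $(c;r)_n=\prod_{i=0}^{n-1}(1-c\,r^i)$. Then the following identities hold in $\mathbb{Z}[[x,q]]$, the double sums converging coefficientwise: $$T_1(x)=\sum_{m,n\ge 0}\frac{q^{4\binom{m+1}{2}+2mn+\binom{n+1}{2}+n}\,x^{2m+n}}{(q^2;q^2)_m(q;q)_n},$$ $$T_2(x)=\sum_{m,n\ge 0}\frac{q^{4\binom{m+1}{2}+2mn+\binom{n+1}{2}}\,x^{2m+n}}{(q^2;q^2)_m(q;q)_n},$$ $$T_3(x)=\sum_{m,n\ge 0}\frac{q^{4\binom{m+1}{2}+2mn+\binom{n+1}{2}-2m}\,x^{2m+n}}{(q^2;q^2)_m(q;q)_n}.$$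 -/

import Mathlib

open scoped MvPowerSeries.WithPiTopology

namespace RRG

/-- The parts `λ₁ ≥ λ₂ ≥ ⋯` of a partition, listed in weakly decreasing order. -/
def partList {n : ℕ} (p : n.Partition) : List ℕ :=
  p.parts.sort (· ≥ ·)

/-- The Rogers–Ramanujan–Gordon difference conditions with parameters `1 ≤ a ≤ k`:
`λ_i ≥ λ_{i+k-1} + 2` whenever both parts exist, and `1` occurs at most `a - 1` times. -/
def IsRRG (k a : ℕ) {n : ℕ} (p : n.Partition) : Prop :=
  (∀ (i : ℕ) (h : i + (k - 1) < (partList p).length),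
      (partList p)[i + (k - 1)] + 2 ≤ (partList p)[i]) ∧
    p.parts.count 1 ≤ a - 1

/-- `rrg k a m n` is the number of partitions of `n` into exactly `m` parts that satisfy the
difference conditions with parameters `k` and `a`. -/
noncomputable def rrg (k a m n : ℕ) : ℕ :=
  Nat.card {p : n.Partition // Multiset.card p.parts = m ∧ IsRRG k a p}

/-- Formal power series over `ℤ` in two variables: index `0` is `x` and index `1` is `q`.
With `ℤ` discrete, the scoped topology on this ring is that of coefficientwise (eventually
constant) convergence. -/
abbrev Series : Type := MvPowerSeries (Fin 2) ℤ

/-- The variable marking the number of parts. -/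
noncomputable def x : Series := MvPowerSeries.X 0

/-- The variable marking the weight. -/
noncomputable def q : Series := MvPowerSeries.X 1

/-- `T a = ∑_{m,n ≥ 0} rrg_{3,a}(m,n) x^m q^n`. -/
noncomputable def T (a : ℕ) : Series :=
  fun d : Fin 2 →₀ ℕ => (rrg 3 a (d 0) (d 1) : ℤ)

/-- The `q`-Pochhammer symbol `(c; r)_n = ∏_{i < n} (1 - c r^i)`. -/
noncomputable def qPochhammer (c r : Series) (n : ℕ) : Series :=
  ∏ i ∈ Finset.range n, (1 - c * r ^ i)

/-- The denominator `(q²; q²)_m (q; q)_n`. -/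
noncomputable def denom (m n : ℕ) : Series :=
  qPochhammer (q ^ 2) (q ^ 2) m * qPochhammer q q n

/-- The inverse of the denominator in the ring of formal power series. -/
noncomputable def invDenom (m n : ℕ) : Series :=
  MvPowerSeries.invOfUnit (denom m n) 1

theorem denom_mul_invDenom (m n : ℕ) : denom m n * invDenom m n = 1 := by
  apply MvPowerSeries.mul_invOfUnit
  simp [denom, qPochhammer, q]

/-- The exponent `4·C(m+1,2) + 2mn + C(n+1,2) - 2m` involves no truncated subtraction. -/
theorem two_mul_le_exponent (m n : ℕ) :
    2 * m ≤ 4 * (m + 1).choose 2 + 2 * m * n + (n + 1).choose 2 := by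
  have h : m ≤ (m + 1).choose 2 := by
    rw [Nat.choose_succ_succ' m 1, Nat.choose_one_right]
    exact Nat.le_add_right _ _
  omega

end RRG

/-! Both sides satisfy the system `T₁(x) = T₃(xq)`, `T₂(x) = T₁(x) + xq T₂(xq)`, `T₃(x) = T₂(x) +
x²q² T₁(xq)`, which with constant term `1` has only one solution (`IsSolution.unique`). For
partitions, fix the number of ones, delete them and lower the other parts by one (`onesSets_add`).
For the double sums, termwise differences produce a factor `1 - q^n` or `1 - q^(2m)` that cancels in
the denominator, and an index shift finishes (`sumRow_snd_succ`, `sumRow_trd_add_two`). -/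

namespace RRG

/-! ### Difference conditions as bounds on multiplicities -/

/-- The condition that any two consecutive positive integers occur at most twice in total. -/
def GapCond (s : Multiset ℕ) : Prop :=
  ∀ v, 1 ≤ v → s.count v + s.count (v + 1) ≤ 2

/-- If the head `a` is `v` or `v + 1`, the third entry is at most `a - 2 < v`, so only the first two
entries can count; otherwise the head does not count. -/
theorem gap_of_window {l : List ℕ} (hl : l.Pairwise (· ≥ ·))
    (h : ∀ (i : ℕ) (hi : i + 2 < l.length), l[i + 2] + 2 ≤ l[i]) (v : ℕ) :
    l.count v + l.count (v + 1) ≤ 2 := by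
  induction l with
  | nil => simp
  | cons a t ih =>
    have ht := ih hl.of_cons fun i hi =>
      h (i + 1) (by rw [List.length_cons]; omega)
    match t, hl, h, ht with
    | [], _, _, _ =>
      simp only [List.count_cons, List.count_nil]
      grind
    | [b], _, _, _ =>
      simp only [List.count_cons, List.count_nil]
      grind
    | b :: c :: r, hl, h, ht =>
      have h0 : c + 2 ≤ a := by simpa using h 0 (by simp)
      have hr : ∀ w ∈ r, w ≤ c := fun _ => List.rel_of_pairwise_cons hl.of_cons.of_cons
      by_cases ha : a = v ∨ a = v + 1
      · have h1 : r.count v = 0 := List.count_eq_zero.2 fun hv => by have := hr _ hv; omega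
        have h2 : r.count (v + 1) = 0 := List.count_eq_zero.2 fun hv => by have := hr _ hv; omega
        simp only [List.count_cons, h1, h2]
        grind
      · rw [List.count_cons_of_ne (a := v) (by omega),
          List.count_cons_of_ne (a := v + 1) (by omega)]
        exact ht

/-- If the third entry `c` exceeded `a - 2`, the first three entries would all be `c` or `c + 1`. -/
theorem window_of_gap {l : List ℕ} (hl : l.Pairwise (· ≥ ·)) (hp : ∀ v ∈ l, 1 ≤ v)
    (h : ∀ v, 1 ≤ v → l.count v + l.count (v + 1) ≤ 2)
    (i : ℕ) (hi : i + 2 < l.length) : l[i + 2] + 2 ≤ l[i] := by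
  induction l generalizing i with
  | nil => simp at hi
  | cons a t ih =>
    cases i with
    | succ i =>
      simpa using ih hl.of_cons (fun v hv => hp v (by simp [hv]))
        (fun v hv => le_trans (Nat.add_le_add List.count_le_count_cons List.count_le_count_cons)
          (h v hv)) i (by rw [List.length_cons] at hi; omega)
    | zero =>
      match t, hl, h, hp, hi with
      | b :: c :: r, hl, h, hp, hi =>
        by_contra hlt
        have hlt : ¬ c + 2 ≤ a := by simpa using hlt
        have := h c (hp c (by simp))
        simp only [List.count_cons] at this
        grind

/-- The multisets of parts of the partitions counted by `rrg 3 a m n`, where `1` may occur at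
most `b = a - 1` times. -/
def partSets (b m n : ℕ) : Set (Multiset ℕ) :=
  {s | (∀ v ∈ s, 1 ≤ v) ∧ s.sum = n ∧ s.card = m ∧ GapCond s ∧ s.count 1 ≤ b}

theorem isRRG_iff (a : ℕ) {n : ℕ} (p : n.Partition) :
    IsRRG 3 a p ↔ GapCond p.parts ∧ p.parts.count 1 ≤ a - 1 := by
  have hs : (partList p).Pairwise (· ≥ ·) := p.parts.pairwise_sort (· ≥ ·)
  have hc : ∀ v, p.parts.count v = (partList p).count v := fun v => by
    rw [← Multiset.coe_count, partList, Multiset.sort_eq]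
  refine and_congr ⟨fun h v _ => ?_, fun h => ?_⟩ Iff.rfl
  · rw [hc, hc]
    exact gap_of_window hs h v
  · refine window_of_gap hs (fun v hv => p.parts_pos ?_) fun v hv => ?_
    · simpa [partList] using hv
    · rw [← hc, ← hc]
      exact h v hv

theorem rrg_eq_ncard (a m n : ℕ) : rrg 3 a m n = (partSets (a - 1) m n).ncard := by
  rw [rrg, ← Nat.card_coe_set_eq]
  refine Nat.card_congr
    { toFun := fun p => ⟨p.1.parts, fun v hv => p.1.parts_pos hv, p.1.parts_sum, p.2.1,
        (isRRG_iff a p.1).1 p.2.2⟩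
      invFun := fun s => ⟨⟨s.1, fun hv => s.2.1 _ hv, s.2.2.1⟩, s.2.2.2.1,
        (isRRG_iff a _).2 s.2.2.2.2⟩
      left_inv := fun _ => rfl
      right_inv := fun _ => rfl }

theorem partSets_finite (b m n : ℕ) : (partSets b m n).Finite := by
  refine (Set.finite_range (Nat.Partition.parts (n := n))).subset fun s hs => ?_
  exact ⟨⟨s, fun hv => hs.1 _ hv, hs.2.1⟩, rfl⟩

/-! ### Deleting the ones and lowering the parts -/

/-- The members of `partSets b m n` with `b ≥ j` in which `1` occurs exactly `j` times. -/
def onesSets (j m n : ℕ) : Set (Multiset ℕ) :=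
  {s | (∀ v ∈ s, 1 ≤ v) ∧ s.sum = n ∧ s.card = m ∧ GapCond s ∧ s.count 1 = j}

theorem partSets_zero (m n : ℕ) : partSets 0 m n = onesSets 0 m n := by
  simp [partSets, onesSets]

theorem onesSets_subset (j m n : ℕ) : onesSets j m n ⊆ partSets j m n :=
  fun _ hs => ⟨hs.1, hs.2.1, hs.2.2.1, hs.2.2.2.1, hs.2.2.2.2.le⟩

theorem ncard_partSets_succ (b m n : ℕ) :
    (partSets (b + 1) m n).ncard = (partSets b m n).ncard + (onesSets (b + 1) m n).ncard := by
  rw [← Set.ncard_union_eq _ (partSets_finite _ _ _)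
    ((partSets_finite _ _ _).subset (onesSets_subset _ _ _))]
  · congr 1
    ext s
    simp only [partSets, onesSets, Set.mem_union, Set.mem_ofPred_eq, Nat.le_succ_iff]
    tauto
  · refine Set.disjoint_left.2 fun s h1 h2 => ?_
    have := h1.2.2.2.2
    have := h2.2.2.2.2
    omega

/-- Raise every part by one and adjoin `j` parts equal to `1`. -/
def raise (j : ℕ) (s : Multiset ℕ) : Multiset ℕ :=
  s.map (· + 1) + Multiset.replicate j 1

theorem raise_injective (j : ℕ) : Function.Injective (raise j) := fun _ _ h =>
  Multiset.map_injective (add_left_injective 1) (add_right_cancel h)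

theorem count_one_raise {s : Multiset ℕ} (hs : ∀ v ∈ s, 1 ≤ v) (j : ℕ) :
    (raise j s).count 1 = j := by
  rw [raise, Multiset.count_add, Multiset.count_replicate_self, Multiset.count_eq_zero.2, zero_add]
  simp only [Multiset.mem_map, not_exists, not_and]
  intro v hv
  have := hs v hv
  omega

theorem count_succ_raise (s : Multiset ℕ) (j : ℕ) {v : ℕ} (hv : 1 ≤ v) :
    (raise j s).count (v + 1) = s.count v := by
  rw [raise, Multiset.count_add, Multiset.count_replicate, if_neg (by omega), add_zero,
    Multiset.count_map_eq_count' _ _ (add_left_injective 1)]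

/-- The values `1, 2` of `raise j s` give the bound `j + s.count 1 ≤ 2`; every other pair of values
is a shifted pair of `s`. -/
theorem gapCond_raise {s : Multiset ℕ} (hs : ∀ v ∈ s, 1 ≤ v) {j : ℕ} (hj : j ≤ 2) :
    GapCond (raise j s) ↔ GapCond s ∧ s.count 1 ≤ 2 - j := by
  constructor
  · refine fun h => ⟨fun v hv => ?_, ?_⟩
    · simpa only [count_succ_raise s j hv, count_succ_raise s j (Nat.le_succ_of_le hv)]
        using h (v + 1) (by omega)
    · have := h 1 le_rfl
      rw [count_one_raise hs, count_succ_raise s j le_rfl] at this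
      omega
  · rintro ⟨h, h1⟩ v hv
    obtain rfl | ⟨w, hw, rfl⟩ : v = 1 ∨ ∃ w, 1 ≤ w ∧ v = w + 1 := by
      rcases v with _ | _ | v
      · omega
      · exact Or.inl rfl
      · exact Or.inr ⟨v + 1, by omega, rfl⟩
    · rw [count_one_raise hs, count_succ_raise s j le_rfl]
      omega
    · rw [count_succ_raise s j hw, count_succ_raise s j (Nat.le_succ_of_le hw)]
      exact h w hw

theorem sum_raise (j : ℕ) (s : Multiset ℕ) : (raise j s).sum = s.sum + (s.card + j) := by
  simp [raise, Multiset.sum_map_add, add_assoc]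

theorem card_raise (j : ℕ) (s : Multiset ℕ) : (raise j s).card = s.card + j := by
  simp [raise]

theorem exists_raise_eq {s : Multiset ℕ} (hs : ∀ v ∈ s, 1 ≤ v) :
    ∃ t : Multiset ℕ, (∀ v ∈ t, 1 ≤ v) ∧ raise (s.count 1) t = s := by
  refine ⟨(s.filter (· ≠ 1)).map (· - 1), ?_, ?_⟩
  · simp only [Multiset.mem_map, Multiset.mem_filter]
    rintro v ⟨w, ⟨hw, hw1⟩, rfl⟩
    have := hs w hw
    omega
  · rw [raise, Multiset.map_map, Multiset.map_congr rfl (g := id), Multiset.map_id,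
      ← Multiset.filter_eq' s 1]
    · simpa [add_comm] using Multiset.filter_add_not (· = 1) s
    · intro v hv
      have := hs v (Multiset.mem_filter.1 hv).1
      simp only [Function.comp_apply, id_eq]
      omega

theorem onesSets_add {j : ℕ} (hj : j ≤ 2) (m n : ℕ) :
    onesSets j (m + j) (n + (m + j)) = raise j '' partSets (2 - j) m n := by
  ext s
  constructor
  · rintro ⟨hs, hsum, hcard, hgap, rfl⟩
    obtain ⟨t, ht, hts⟩ := exists_raise_eq hs
    generalize s.count 1 = j at *
    subst hts
    rw [card_raise] at hcard
    rw [sum_raise] at hsum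
    have hg := (gapCond_raise ht hj).1 hgap
    exact ⟨t, ⟨ht, by omega, by omega, hg⟩, rfl⟩
  · rintro ⟨t, ⟨ht, hsum, hcard, hg⟩, rfl⟩
    refine ⟨fun v hv => ?_, by rw [sum_raise, hsum, hcard], by rw [card_raise, hcard],
      (gapCond_raise ht hj).2 hg, count_one_raise ht j⟩
    rcases Multiset.mem_add.1 hv with hv | hv
    · obtain ⟨w, -, rfl⟩ := Multiset.mem_map.1 hv
      omega
    · exact (Multiset.eq_of_mem_replicate hv).ge

theorem card_le_sum {s : Multiset ℕ} (hs : ∀ v ∈ s, 1 ≤ v) : s.card ≤ s.sum := by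
  simpa using Multiset.card_nsmul_le_sum hs

/-! ### The functional equations and their unique solution -/

/-- The coefficient of `x ^ m` in `T a`, as a power series in `q`. -/
noncomputable def row (a m : ℕ) : PowerSeries ℤ :=
  PowerSeries.mk fun n => (rrg 3 a m n : ℤ)

/-- This is the coefficient of `x^(m+j)` in `x^j q^j T_(3-j)(xq)`. -/
theorem mk_onesSets {j : ℕ} (hj : j ≤ 2) (m : ℕ) :
    PowerSeries.mk (fun n => ((onesSets j (m + j) n).ncard : ℤ)) =
      PowerSeries.X ^ (m + j) * row (3 - j) m := by
  ext n
  rw [PowerSeries.coeff_mk, PowerSeries.coeff_X_pow_mul']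
  split_ifs with h
  · obtain ⟨k, rfl⟩ := Nat.exists_eq_add_of_le' h
    rw [onesSets_add hj, Set.ncard_image_of_injective _ (raise_injective j), row,
      PowerSeries.coeff_mk, rrg_eq_ncard, Nat.add_sub_cancel, show 3 - j - 1 = 2 - j by omega]
  · rw [Set.eq_empty_of_forall_notMem (s := onesSets j (m + j) n), Set.ncard_empty, Nat.cast_zero]
    rintro s ⟨hs, hsum, hcard, -⟩
    have := card_le_sum hs
    omega

theorem mk_onesSets_of_lt {j m : ℕ} (h : m < j) :
    PowerSeries.mk (fun n => ((onesSets j m n).ncard : ℤ)) = 0 := by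
  ext n
  rw [PowerSeries.coeff_mk, Set.eq_empty_of_forall_notMem (s := onesSets j m n), Set.ncard_empty,
    Nat.cast_zero, map_zero]
  rintro s ⟨-, -, hcard, -, hc⟩
  have := Multiset.count_le_card 1 s
  omega

theorem row_succ_succ (b m : ℕ) :
    row (b + 2) m =
      row (b + 1) m + PowerSeries.mk (fun n => ((onesSets (b + 1) m n).ncard : ℤ)) := by
  ext n
  simp [row, rrg_eq_ncard, ncard_partSets_succ]

theorem row_one (m : ℕ) : row 1 m = PowerSeries.X ^ m * row 3 m := by
  refine Eq.trans ?_ (mk_onesSets (Nat.zero_le 2) m)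
  ext n
  simp [row, rrg_eq_ncard, partSets_zero]

theorem row_three_zero : row 3 0 = 1 := by
  ext n
  rw [row, PowerSeries.coeff_mk, rrg_eq_ncard, PowerSeries.coeff_one]
  have : partSets (3 - 1) 0 n = if n = 0 then {0} else ∅ := by
    ext s
    simp only [partSets, Set.mem_ofPred_eq, Multiset.card_eq_zero]
    split_ifs with h
    · simp only [Set.mem_singleton_iff]
      refine ⟨fun hs => hs.2.2.1, ?_⟩
      rintro rfl
      simp [h, GapCond]
    · simp only [Set.mem_empty_iff_false, iff_false]
      rintro ⟨-, hsum, rfl, -⟩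
      exact h (by simpa using hsum.symm)
  rw [this]
  split_ifs <;> simp

/-- The systems of `x`-coefficients of triples of series `T₁, T₂, T₃` with constant coefficient `1`
such that `T₁(x) = T₃(xq)`, `T₂(x) = T₁(x) + xq T₂(xq)` and `T₃(x) = T₂(x) + x²q² T₁(xq)`. -/
structure IsSolution (f g h : ℕ → PowerSeries ℤ) : Prop where
  init : h 0 = 1
  fst (m : ℕ) : f m = PowerSeries.X ^ m * h m
  snd_zero : g 0 = f 0
  snd_succ (m : ℕ) : g (m + 1) = f (m + 1) + PowerSeries.X ^ (m + 1) * g m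
  trd_one : h 1 = g 1
  trd_add_two (m : ℕ) : h (m + 2) = g (m + 2) + PowerSeries.X ^ (m + 2) * f m

theorem one_sub_X_pow_succ_ne_zero (m : ℕ) : (1 : PowerSeries ℤ) - PowerSeries.X ^ (m + 1) ≠ 0 :=
  fun h => by simpa using congrArg PowerSeries.constantCoeff h

/-- Eliminating `f m` and `g m` expresses `(1 - X^m) * h m`, for `m ≥ 1`, through `g (m - 1)` and `f
(m - 2)`, and `1 - X^m` is not a zero divisor. -/
theorem IsSolution.unique {f g h f' g' h' : ℕ → PowerSeries ℤ} (H : IsSolution f g h)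
    (H' : IsSolution f' g' h') : f = f' ∧ g = g' ∧ h = h' := by
  suffices ∀ m, f m = f' m ∧ g m = g' m ∧ h m = h' m from
    ⟨funext fun m => (this m).1, funext fun m => (this m).2.1, funext fun m => (this m).2.2⟩
  intro m
  induction m using Nat.strong_induction_on with
  | _ m ih =>
    have key : h m = h' m := by
      match m, ih with
      | 0, _ => rw [H.init, H'.init]
      | 1, ih =>
        refine mul_left_cancel₀ (one_sub_X_pow_succ_ne_zero 0) ?_
        linear_combination H.trd_one + H.snd_succ 0 + H.fst 1 - H'.trd_one - H'.snd_succ 0 -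
          H'.fst 1 + PowerSeries.X * (ih 0 one_pos).2.1
      | m + 2, ih =>
        refine mul_left_cancel₀ (one_sub_X_pow_succ_ne_zero (m + 1)) ?_
        linear_combination H.trd_add_two m + H.snd_succ (m + 1) + H.fst (m + 2) -
          H'.trd_add_two m - H'.snd_succ (m + 1) - H'.fst (m + 2) +
          PowerSeries.X ^ (m + 2) * (ih (m + 1) (by omega)).2.1 +
          PowerSeries.X ^ (m + 2) * (ih m (by omega)).1
    have key1 : f m = f' m := by rw [H.fst, H'.fst, key]
    refine ⟨key1, ?_, key⟩
    cases m with
    | zero => rw [H.snd_zero, H'.snd_zero, key1]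
    | succ m => rw [H.snd_succ, H'.snd_succ, key1, (ih m (by omega)).2.1]

theorem isSolution_row : IsSolution (row 1) (row 2) (row 3) where
  init := row_three_zero
  fst := row_one
  snd_zero := by rw [row_succ_succ 0, mk_onesSets_of_lt (by omega), add_zero]
  snd_succ m := by rw [row_succ_succ 0, mk_onesSets (by omega)]
  trd_one := by rw [row_succ_succ 1, mk_onesSets_of_lt (by omega), add_zero]
  trd_add_two m := by rw [row_succ_succ 1, mk_onesSets (by omega)]

/-! ### The double sums solve the same equations -/

/-- The denominator `(q²; q²)_m (q; q)_n` as a power series in `q` alone. -/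
noncomputable def denomPS (m n : ℕ) : PowerSeries ℤ :=
  (∏ i ∈ Finset.range m, (1 - PowerSeries.X ^ 2 * (PowerSeries.X ^ 2) ^ i)) *
    ∏ i ∈ Finset.range n, (1 - PowerSeries.X * PowerSeries.X ^ i)

/-- The inverse of `denomPS m n`. -/
noncomputable def invDenomPS (m n : ℕ) : PowerSeries ℤ :=
  PowerSeries.invOfUnit (denomPS m n) 1

theorem denomPS_mul_invDenomPS (m n : ℕ) : denomPS m n * invDenomPS m n = 1 := by
  apply PowerSeries.mul_invOfUnit
  simp [denomPS]

theorem toMvPowerSeries_denomPS (m n : ℕ) :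
    PowerSeries.toMvPowerSeries 1 (denomPS m n) = denom m n := by
  simp [denomPS, denom, qPochhammer, q]

theorem toMvPowerSeries_invDenomPS (m n : ℕ) :
    PowerSeries.toMvPowerSeries 1 (invDenomPS m n) = invDenom m n := by
  refine left_inv_eq_right_inv (a := denom m n) ?_ (denom_mul_invDenom m n)
  rw [← toMvPowerSeries_denomPS, ← map_mul, mul_comm, denomPS_mul_invDenomPS, map_one]

theorem one_sub_mul_invDenomPS_succ_right (m n : ℕ) :
    (1 - PowerSeries.X ^ (n + 1)) * invDenomPS m (n + 1) = invDenomPS m n := by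
  refine left_inv_eq_right_inv (a := denomPS m n) ?_ (denomPS_mul_invDenomPS m n)
  have h := denomPS_mul_invDenomPS m (n + 1)
  rw [denomPS, Finset.prod_range_succ] at h
  rw [denomPS]
  linear_combination h

theorem one_sub_mul_invDenomPS_succ_left (m n : ℕ) :
    (1 - PowerSeries.X ^ (2 * (m + 1))) * invDenomPS (m + 1) n = invDenomPS m n := by
  refine left_inv_eq_right_inv (a := denomPS m n) ?_ (denomPS_mul_invDenomPS m n)
  have h := denomPS_mul_invDenomPS (m + 1) n
  rw [denomPS, Finset.prod_range_succ] at h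
  rw [denomPS]
  linear_combination h

/-- The pairs `(i, j)` with `2 i + j = m`. -/
def pairs (m : ℕ) : Finset (ℕ × ℕ) :=
  (Finset.range (m + 1) ×ˢ Finset.range (m + 1)).filter fun p => 2 * p.1 + p.2 = m

theorem mem_pairs {m : ℕ} {p : ℕ × ℕ} : p ∈ pairs m ↔ 2 * p.1 + p.2 = m := by
  simp only [pairs, Finset.mem_filter, Finset.mem_product, Finset.mem_range]
  omega

theorem sum_pairs_succ {M : Type*} [AddCommMonoid M] (f : ℕ × ℕ → M) (hf : ∀ i, f (i, 0) = 0)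
    (m : ℕ) : ∑ p ∈ pairs (m + 1), f p = ∑ p ∈ pairs m, f (p.1, p.2 + 1) := by
  symm
  refine Finset.sum_of_injOn (fun p => (p.1, p.2 + 1)) ?_ ?_ ?_ fun _ _ => rfl
  · rintro ⟨i, j⟩ - ⟨k, l⟩ - h
    simpa using h
  · intro p hp
    have := mem_pairs.1 (Finset.mem_coe.1 hp)
    exact Finset.mem_coe.2 (mem_pairs.2 (by dsimp only; omega))
  · rintro ⟨i, j⟩ hp hn
    cases j with
    | zero => exact hf i
    | succ j =>
      refine absurd ⟨(i, j), ?_, rfl⟩ hn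
      have := mem_pairs.1 hp
      exact Finset.mem_coe.2 (mem_pairs.2 (by dsimp only at this ⊢; omega))

theorem sum_pairs_add_two {M : Type*} [AddCommMonoid M] (f : ℕ × ℕ → M)
    (hf : ∀ j, f (0, j) = 0) (m : ℕ) :
    ∑ p ∈ pairs (m + 2), f p = ∑ p ∈ pairs m, f (p.1 + 1, p.2) := by
  symm
  refine Finset.sum_of_injOn (fun p => (p.1 + 1, p.2)) ?_ ?_ ?_ fun _ _ => rfl
  · rintro ⟨i, j⟩ - ⟨k, l⟩ - h
    simpa using h
  · intro p hp
    have := mem_pairs.1 (Finset.mem_coe.1 hp)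
    exact Finset.mem_coe.2 (mem_pairs.2 (by dsimp only; omega))
  · rintro ⟨i, j⟩ hp hn
    cases i with
    | zero => exact hf j
    | succ i =>
      refine absurd ⟨(i, j), ?_, rfl⟩ hn
      have := mem_pairs.1 hp
      exact Finset.mem_coe.2 (mem_pairs.2 (by dsimp only at this ⊢; omega))

/-- The coefficient of `x ^ m` in the double sum whose terms have the `q`-exponents `e`. -/
noncomputable def sumRow (e : ℕ × ℕ → ℕ) (m : ℕ) : PowerSeries ℤ :=
  ∑ p ∈ pairs m, PowerSeries.X ^ e p * invDenomPS p.1 p.2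

/-- The exponent `4·C(m+1,2) + 2mn + C(n+1,2)`. -/
def expo (p : ℕ × ℕ) : ℕ :=
  4 * (p.1 + 1).choose 2 + 2 * p.1 * p.2 + (p.2 + 1).choose 2

theorem choose_add_two_two (n : ℕ) : (n + 2).choose 2 = (n + 1).choose 2 + (n + 1) := by
  rw [Nat.choose_succ_succ' (n + 1) 1, Nat.choose_one_right, add_comm]

theorem expo_succ_right (i j : ℕ) : expo (i, j + 1) = expo (i, j) + (2 * i + j + 1) := by
  simp only [expo, choose_add_two_two]
  ring

theorem expo_succ_left (i j : ℕ) : expo (i + 1, j) = expo (i, j) + (4 * i + 4 + 2 * j) := by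
  simp only [expo, choose_add_two_two]
  ring

theorem two_mul_le_expo (p : ℕ × ℕ) : 2 * p.1 ≤ expo p := two_mul_le_exponent p.1 p.2

theorem sumRow_fst (m : ℕ) : sumRow (fun p => expo p + p.2) m =
    PowerSeries.X ^ m * sumRow (fun p => expo p - 2 * p.1) m := by
  rw [sumRow, sumRow, Finset.mul_sum]
  refine Finset.sum_congr rfl fun p hp => ?_
  have h1 := mem_pairs.1 hp
  have h2 := two_mul_le_expo p
  rw [← mul_assoc, ← pow_add]
  congr 2
  omega

/-- The difference of the terms at `(i, j)` contains `1 - X^j`, which vanishes at `j = 0` and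
otherwise cancels the last factor of `(q; q)_j`. -/
theorem sumRow_snd_succ (m : ℕ) : sumRow expo (m + 1) =
    sumRow (fun p => expo p + p.2) (m + 1) + PowerSeries.X ^ (m + 1) * sumRow expo m := by
  rw [← sub_eq_iff_eq_add', sumRow, sumRow, sumRow, ← Finset.sum_sub_distrib, sum_pairs_succ,
    Finset.mul_sum]
  · refine Finset.sum_congr rfl fun p hp => ?_
    have h1 := mem_pairs.1 hp
    rw [← one_sub_mul_invDenomPS_succ_right p.1 p.2, expo_succ_right, h1]
    ring
  · simp

/-- Here the difference contains `1 - X^(2i)`, which cancels the last factor of `(q²; q²)_i`. -/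
theorem sumRow_trd_add_two (m : ℕ) : sumRow (fun p => expo p - 2 * p.1) (m + 2) =
    sumRow expo (m + 2) + PowerSeries.X ^ (m + 2) * sumRow (fun p => expo p + p.2) m := by
  rw [← sub_eq_iff_eq_add', sumRow, sumRow, sumRow, ← Finset.sum_sub_distrib, sum_pairs_add_two,
    Finset.mul_sum]
  · refine Finset.sum_congr rfl fun p hp => ?_
    have h1 := mem_pairs.1 hp
    rw [← one_sub_mul_invDenomPS_succ_left p.1 p.2, expo_succ_left,
      show expo p + (4 * p.1 + 4 + 2 * p.2) - 2 * (p.1 + 1) =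
        m + 2 + (expo p + p.2) by have := two_mul_le_expo p; omega,
      show expo p + (4 * p.1 + 4 + 2 * p.2) =
        m + 2 + (expo p + p.2) + 2 * (p.1 + 1) by omega]
    ring
  · simp

theorem isSolution_sumRow : IsSolution (sumRow fun p => expo p + p.2) (sumRow expo)
    (sumRow fun p => expo p - 2 * p.1) where
  init := by
    have h : pairs 0 = {(0, 0)} := by decide
    have h1 := denomPS_mul_invDenomPS 0 0
    simpa [sumRow, h, expo, denomPS] using h1
  fst := sumRow_fst
  snd_zero := by
    have h : pairs 0 = {(0, 0)} := by decide
    simp [sumRow, h]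
  snd_succ := sumRow_snd_succ
  trd_one := by
    have h : pairs 1 = {(0, 1)} := by decide
    simp [sumRow, h]
  trd_add_two := sumRow_trd_add_two

/-! ### From rows to series in two variables -/

theorem coeff_toMvPowerSeries_mul_x_pow (f : PowerSeries ℤ) (m : ℕ) (d : Fin 2 →₀ ℕ) :
    MvPowerSeries.coeff d (PowerSeries.toMvPowerSeries 1 f * x ^ m) =
      if d 0 = m then PowerSeries.coeff (d 1) f else 0 := by
  have hd : d - Finsupp.single 0 (d 0) = Finsupp.single 1 (d 1) := by
    ext i
    fin_cases i <;> simp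
  have hdom (y : Unit →₀ ℕ) :
      Finsupp.mapDomain (fun _ => (1 : Fin 2)) y = Finsupp.single 1 (y ()) := by
    conv_lhs => rw [Finsupp.unique_single y, Finsupp.mapDomain_single]
  have hzero (k : Fin 2 →₀ ℕ) (hk : k 0 ≠ 0) :
      MvPowerSeries.coeff k (PowerSeries.toMvPowerSeries 1 f) = 0 := by
    rw [PowerSeries.toMvPowerSeries_apply]
    refine MvPowerSeries.coeff_rename_eq_zero _ _ ?_
    rintro ⟨y, rfl⟩
    simp [hdom] at hk
  have hone (k : ℕ) : MvPowerSeries.coeff (Finsupp.single (1 : Fin 2) k)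
      (PowerSeries.toMvPowerSeries 1 f) = PowerSeries.coeff k f := by
    have := MvPowerSeries.coeff_embDomain_rename ⟨fun _ : Unit => (1 : Fin 2), fun _ _ _ => rfl⟩ f
      (Finsupp.single () k)
    rw [Finsupp.embDomain_single] at this
    exact this
  rw [x, MvPowerSeries.X_pow_eq, MvPowerSeries.coeff_mul_monomial, mul_one]
  by_cases h : d 0 = m
  · subst h
    rw [if_pos rfl, if_pos (by simp), hd, hone]
  · rw [if_neg h]
    split_ifs with hle
    · refine hzero _ ?_
      have := (Finsupp.single_le_iff.1 hle)
      simp only [Finsupp.coe_tsub, Pi.sub_apply, Finsupp.single_eq_same]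
      omega
    · rfl

/-- For each `d` only the finitely many index pairs in `pairs (d 0)` contribute, so convergence is
immediate. -/
theorem hasSum_of_row_eq_sumRow {a : ℕ} {e : ℕ × ℕ → ℕ} (h : row a = sumRow e) :
    HasSum (fun i : ℕ × ℕ => q ^ e i * x ^ (2 * i.1 + i.2) * invDenom i.1 i.2) (T a) := by
  rw [MvPowerSeries.WithPiTopology.hasSum_iff_hasSum_coeff]
  intro d
  have hterm (i : ℕ × ℕ) : MvPowerSeries.coeff d
      (q ^ e i * x ^ (2 * i.1 + i.2) * invDenom i.1 i.2) =
        if d 0 = 2 * i.1 + i.2 then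
          PowerSeries.coeff (d 1) (PowerSeries.X ^ e i * invDenomPS i.1 i.2) else 0 := by
    rw [← coeff_toMvPowerSeries_mul_x_pow, map_mul (PowerSeries.toMvPowerSeries 1), map_pow,
      PowerSeries.toMvPowerSeries_X, toMvPowerSeries_invDenomPS, mul_right_comm, q]
  have hT : MvPowerSeries.coeff d (T a) =
      ∑ p ∈ pairs (d 0), MvPowerSeries.coeff d
        (q ^ e p * x ^ (2 * p.1 + p.2) * invDenom p.1 p.2) := by
    have h1 : MvPowerSeries.coeff d (T a) = PowerSeries.coeff (d 1) (row a (d 0)) := by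
      rw [row, PowerSeries.coeff_mk]
      rfl
    rw [h1, h, sumRow, map_sum]
    refine Finset.sum_congr rfl fun p hp => ?_
    rw [hterm, if_pos (mem_pairs.1 hp).symm]
  rw [hT]
  refine hasSum_sum_of_ne_finset_zero fun p hp => ?_
  rw [hterm, if_neg fun h => hp (mem_pairs.2 h.symm)]

end RRG

theorem mainTheorem1 :
    HasSum
      (fun i : ℕ × ℕ =>
        RRG.q ^ (4 * (i.1 + 1).choose 2 + 2 * i.1 * i.2 + (i.2 + 1).choose 2 + i.2) *
          RRG.x ^ (2 * i.1 + i.2) * RRG.invDenom i.1 i.2)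
      (RRG.T 1) ∧
    HasSum
      (fun i : ℕ × ℕ =>
        RRG.q ^ (4 * (i.1 + 1).choose 2 + 2 * i.1 * i.2 + (i.2 + 1).choose 2) *
          RRG.x ^ (2 * i.1 + i.2) * RRG.invDenom i.1 i.2)
      (RRG.T 2) ∧
    HasSum
      (fun i : ℕ × ℕ =>
        RRG.q ^ (4 * (i.1 + 1).choose 2 + 2 * i.1 * i.2 + (i.2 + 1).choose 2 - 2 * i.1) *
          RRG.x ^ (2 * i.1 + i.2) * RRG.invDenom i.1 i.2)
      (RRG.T 3) := by
  obtain ⟨h1, h2, h3⟩ := RRG.isSolution_row.unique RRG.isSolution_sumRow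
  exact ⟨RRG.hasSum_of_row_eq_sumRow h1, RRG.hasSum_of_row_eq_sumRow h2,
    RRG.hasSum_of_row_eq_sumRow h3⟩
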